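/- Let $d\ge 0$ be an integer and let $\mathcal P_2(\mathbb R^d)$ be the set of Borel probability measures on $\mathbb R^d$ with finite second moment. For $\mu,\nu\in\mathcal P_2(\mathbb R^d)$ let $\Pi(\mu,\nu)$ be the set of couplings of $\mu$ and $\nu$, i.e. probability measures on $\mathbb R^d\times\mathbb R^d$ with marginals $\mu$ and $\nu$, let $W_2(\mu,\nu)=\big(\inf_{\gamma\in\Pi(\mu,\nu)}\int\|x-y\|_2^2\,d\gamma(x,y)\big)^{1/2}$, and let $\Pi_o(\mu,\nu)$ be the set of couplings attaining this infimum. Let $(\mu_t)_{t\ge 0}$ be a geodesic ray in $(\mathcal P_2(\mathbb R^d),W_2)$, i.e. $W_2(\mu_t,\mu_s)=|t-s|\,W_2(\mu_0,\mu_1)$ for all $s,t\ge 0$, with positive speed $\kappa_\mu:=W_2(\mu_0,\mu_1)>0$, and let $\nu\in\mathcal P_2(\mathbb R^d)$. Let $\Gamma(\mu_0,\mu_1,\nu)$ be the set of probability measures $\tilde\gamma$ on $(\mathbb R^d)^3$ with marginals $\mu_0,\mu_1,\nu$ such that the image of $\tilde\gamma$ under $(x_0,x_1,y)\mapsto(x_0,x_1)$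 belongs to $\Pi_o(\mu_0,\mu_1)$. Then the limit $$B^\mu(\nu)=\lim_{t\to\infty}\big(W_2(\mu_t,\nu)-\kappa_\mu t\big)$$ defining the Busemann function exists in $\mathbb R$, the function $(x_0,x_1,y)\mapsto\langle x_1-x_0,y-x_0\rangle$ is integrable with respect to every $\tilde\gamma\in\Gamma(\mu_0,\mu_1,\nu)$, and $$B^\mu(\nu)=\inf_{\tilde\gamma\in\Gamma(\mu_0,\mu_1,\nu)}\ -\kappa_\mu^{-1}\int\langle x_1-x_0,\,y-x_0\rangle\,d\tilde\gamma(x_0,x_1,y),$$ the infimum being over a nonempty set and finite. -/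

import Mathlib

open MeasureTheory Filter Topology
open scoped NNReal ENNReal

noncomputable section

namespace BusemannWasserstein

/-- The Euclidean space `ℝ^d`. -/
abbrev Euc (d : ℕ) : Type := EuclideanSpace ℝ (Fin d)

/-- `𝒫₂(ℝ^d)`: Borel probability measures on `ℝ^d` with finite second moment. -/
def P2 (d : ℕ) : Type :=
  {μ : ProbabilityMeasure (Euc d) // ∫⁻ x, ‖x‖ₑ ^ 2 ∂(μ : Measure (Euc d)) < ∞}

/-- The underlying measure of an element of `𝒫₂(ℝ^d)`. -/
def P2.meas {d : ℕ} (μ : P2 d) : Measure (Euc d) := (μ.1 : Measure (Euc d))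

/-- `Π(μ, ν)`: probability measures on `ℝ^d × ℝ^d` with marginals `μ` and `ν`. -/
def couplings {d : ℕ} (μ ν : P2 d) : Set (Measure (Euc d × Euc d)) :=
  {γ | IsProbabilityMeasure γ ∧ γ.map Prod.fst = μ.meas ∧ γ.map Prod.snd = ν.meas}

/-- The quadratic transport cost `∫ ‖x - y‖² dγ(x, y)`. -/
def cost {d : ℕ} (γ : Measure (Euc d × Euc d)) : ℝ≥0∞ :=
  ∫⁻ p, ‖p.1 - p.2‖ₑ ^ 2 ∂γ

/-- The squared Wasserstein distance, as an extended nonnegative number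
(it is finite on `𝒫₂(ℝ^d)`). -/
def W2sq {d : ℕ} (μ ν : P2 d) : ℝ≥0∞ :=
  ⨅ γ ∈ couplings μ ν, cost γ

/-- The 2-Wasserstein distance. -/
def W2 {d : ℕ} (μ ν : P2 d) : ℝ := Real.sqrt (W2sq μ ν).toReal

/-- `Π_o(μ, ν)`: the optimal couplings. -/
def optimalCouplings {d : ℕ} (μ ν : P2 d) : Set (Measure (Euc d × Euc d)) :=
  {γ | γ ∈ couplings μ ν ∧ cost γ = W2sq μ ν}

/-- `Π(μ₀, μ₁, ν)`: probability measures on `ℝ^d × ℝ^d × ℝ^d`, with points `(x₀, x₁, y)`,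
whose marginals are `μ₀`, `μ₁` and `ν`. -/
def couplings₃ {d : ℕ} (μ₀ μ₁ ν : P2 d) : Set (Measure (Euc d × Euc d × Euc d)) :=
  {γ | IsProbabilityMeasure γ ∧ γ.map (fun p => p.1) = μ₀.meas ∧
    γ.map (fun p => p.2.1) = μ₁.meas ∧ γ.map (fun p => p.2.2) = ν.meas}

/-- `Γ(μ₀, μ₁, ν)`: couplings of `(μ₀, μ₁, ν)` whose projection on the first two coordinates
is an optimal coupling of `μ₀` and `μ₁`. -/
def Gam {d : ℕ} (μ₀ μ₁ ν : P2 d) : Set (Measure (Euc d × Euc d × Euc d)) :=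
  {γ | γ ∈ couplings₃ μ₀ μ₁ ν ∧ γ.map (fun p => (p.1, p.2.1)) ∈ optimalCouplings μ₀ μ₁}

/-- The speed `κ_μ = W₂(μ₀, μ₁)` of a curve. -/
def speed {d : ℕ} (μ : ℝ≥0 → P2 d) : ℝ := W2 (μ 0) (μ 1)

/-- Constant-speed geodesic rays `(μ_t)_{t ≥ 0}` in `(𝒫₂(ℝ^d), W₂)`. -/
def IsGeodesicRay {d : ℕ} (μ : ℝ≥0 → P2 d) : Prop :=
  ∀ s t : ℝ≥0, W2 (μ t) (μ s) = |(t : ℝ) - (s : ℝ)| * W2 (μ 0) (μ 1)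

/-- The Busemann function `B^μ(ν) = lim_{t → ∞} (W₂(μ_t, ν) - κ_μ t)`. -/
def busemann {d : ℕ} (μ : ℝ≥0 → P2 d) (ν : P2 d) : ℝ :=
  limUnder atTop (fun t : ℝ≥0 => W2 (μ t) ν - speed μ * (t : ℝ))

end BusemannWasserstein

end

namespace BusemannWasserstein

open ProbabilityTheory

/-! For `t > 1`, every optimal coupling of `μ 0` and `μ 1` is carried to `μ t` by `x₀ + t (x₁ - x₀)`
(`IsGeodesicRay.map_extrapolate`): equality in the triangle inequality through `μ 1` forces glued
triples onto straight lines. Expanding the square, a 3-plan with `J = ∫ ⟨x₁ - x₀, y - x₀⟩` couples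
`μ t` and `ν` at cost `(κt)² - 2tJ + C`, where `C` does not depend on `t`. Any 3-plan thus bounds
`W2 (μ t) ν` from above. Conversely, an optimal coupling of `μ t` and `ν` lifts by gluing to a
3-plan with exactly that cost, and `C ≥ 0` can be dropped. Since `√(a² + 2ab + C) - a → b` with `a =
κt`, `b = -J/κ`, both bounds converge to the infimum. -/

/-- Gluing lemma: a measure `α` with `f`-marginal `ζ` and a coupling `β` of `ζ` with another
measure are the marginals of a common measure. -/
theorem exists_gluing {A Z Y : Type*} [MeasurableSpace A] [MeasurableSpace Z] [MeasurableSpace Y]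
    [StandardBorelSpace Y] [Nonempty Y] (α : Measure A) [IsProbabilityMeasure α]
    (β : Measure (Z × Y)) [IsProbabilityMeasure β] (f : A → Z) (hf : Measurable f)
    (h : α.map f = β.map Prod.fst) :
    ∃ σ : Measure (A × Y), IsProbabilityMeasure σ ∧ σ.map Prod.fst = α ∧
      σ.map (fun p => (f p.1, p.2)) = β := by
  -- Disintegrate `β` over `Z` and draw the `Y`-coordinate from the conditional law at `f a`.
  refine ⟨α ⊗ₘ (β.condKernel.comap f hf), inferInstance, Measure.fst_compProd _ _, ?_⟩
  have hm : Measurable (fun p : A × Y => (f p.1, p.2)) := by fun_prop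
  conv_rhs => rw [← β.disintegrate β.condKernel]
  ext s hs
  rw [Measure.map_apply hm hs, Measure.compProd_apply (hm hs), Measure.compProd_apply hs,
    Measure.fst, ← h, lintegral_map (Kernel.measurable_kernel_prodMk_left hs) hf]
  rfl

/-! ### Existence of optimal couplings -/

/-- The integral of a continuous nonnegative function is weakly lower semicontinuous. -/
theorem lowerSemicontinuous_lintegral {X : Type*} [TopologicalSpace X] [MeasurableSpace X]
    [OpensMeasurableSpace X] (f : X → ℝ≥0) (hf : Continuous f) :
    LowerSemicontinuous (fun γ : ProbabilityMeasure X => ∫⁻ x, f x ∂(γ : Measure X)) := by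
  -- By monotone convergence the integral is the supremum over the truncations `min f n`, each
  -- weakly continuous in the measure.
  let g : ℕ → BoundedContinuousFunction X ℝ≥0 := fun n =>
    BoundedContinuousFunction.mkOfBound ⟨fun x => min (f x) n, by fun_prop⟩ n (fun x y => by
      rw [NNReal.dist_eq, abs_le]
      have h1 : min (f x) (n : ℝ≥0) ≤ n := min_le_right _ _
      have h2 : min (f y) (n : ℝ≥0) ≤ n := min_le_right _ _
      have h3 : ((min (f x) (n : ℝ≥0) : ℝ≥0) : ℝ) ≤ n := by exact_mod_cast h1
      have h4 : ((min (f y) (n : ℝ≥0) : ℝ≥0) : ℝ) ≤ n := by exact_mod_cast h2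
      have h5 := (min (f x) (n : ℝ≥0)).coe_nonneg
      have h6 := (min (f y) (n : ℝ≥0)).coe_nonneg
      constructor <;> simp only [ContinuousMap.coe_mk] <;> linarith)
  have key : ∀ γ : ProbabilityMeasure X,
      ∫⁻ x, f x ∂(γ : Measure X) = ⨆ n, ∫⁻ x, g n x ∂(γ : Measure X) := by
    intro γ
    rw [← lintegral_iSup]
    · refine lintegral_congr fun x => ?_
      apply le_antisymm
      · obtain ⟨n, hn⟩ := exists_nat_ge (f x)
        refine le_iSup_of_le n ?_
        change (f x : ℝ≥0∞) ≤ ((min (f x) n : ℝ≥0) : ℝ≥0∞)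
        rw [min_eq_left hn]
      · refine iSup_le fun n => ?_
        change ((min (f x) n : ℝ≥0) : ℝ≥0∞) ≤ f x
        exact_mod_cast min_le_left _ _
    · intro n
      exact (g n).continuous.measurable.coe_nnreal_ennreal
    · intro m n hmn x
      change ((min (f x) m : ℝ≥0) : ℝ≥0∞) ≤ ((min (f x) n : ℝ≥0) : ℝ≥0∞)
      have : (m : ℝ≥0) ≤ n := by exact_mod_cast hmn
      exact_mod_cast min_le_min_left _ this
  simp_rw [key]
  exact lowerSemicontinuous_iSup fun n =>
    (ProbabilityMeasure.continuous_lintegral_boundedContinuousFunction (g n)).lowerSemicontinuous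

variable {d : ℕ}

instance (μ : P2 d) : IsProbabilityMeasure μ.meas := μ.1.2

theorem prod_mem_couplings (μ ν : P2 d) : μ.meas.prod ν.meas ∈ couplings μ ν :=
  ⟨inferInstance, Measure.fst_prod, Measure.snd_prod⟩

/-- The couplings of two measures form a weakly compact set. -/
theorem isCompact_couplings (μ ν : P2 d) :
    IsCompact {γ : ProbabilityMeasure (Euc d × Euc d) |
      (γ : Measure (Euc d × Euc d)) ∈ couplings μ ν} := by
  set S := {γ : ProbabilityMeasure (Euc d × Euc d) |
      (γ : Measure (Euc d × Euc d)) ∈ couplings μ ν} with hS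
  have hclosed : IsClosed S := by
    have : S = {γ | γ.map measurable_fst.aemeasurable = μ.1} ∩
        {γ | γ.map measurable_snd.aemeasurable = ν.1} := by
      ext γ
      constructor
      · rintro ⟨-, h1, h2⟩
        exact ⟨Subtype.ext h1, Subtype.ext h2⟩
      · rintro ⟨h1, h2⟩
        exact ⟨γ.2, congrArg Subtype.val h1, congrArg Subtype.val h2⟩
    rw [this]
    exact (isClosed_eq (ProbabilityMeasure.continuous_map continuous_fst) continuous_const).inter
      (isClosed_eq (ProbabilityMeasure.continuous_map continuous_snd) continuous_const)
  rw [← hclosed.closure_eq]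
  apply isCompact_closure_of_isTightMeasureSet
  rw [isTightMeasureSet_iff_exists_isCompact_measure_compl_le]
  intro ε hε
  have hε2 : 0 < ε / 2 := ENNReal.half_pos hε.ne'
  obtain ⟨K, hK, hKε⟩ := isTightMeasureSet_iff_exists_isCompact_measure_compl_le.1
    (isTightMeasureSet_singleton (μ := μ.meas)) (ε / 2) hε2
  obtain ⟨M, hM, hMε⟩ := isTightMeasureSet_iff_exists_isCompact_measure_compl_le.1
    (isTightMeasureSet_singleton (μ := ν.meas)) (ε / 2) hε2
  refine ⟨K ×ˢ M, hK.prod hM, ?_⟩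
  rintro _ ⟨γ, ⟨-, h1, h2⟩, rfl⟩
  have hsub : (K ×ˢ M)ᶜ ⊆ Prod.fst ⁻¹' Kᶜ ∪ (Prod.snd ⁻¹' Mᶜ : Set (Euc d × Euc d)) := by
    intro p hp
    by_cases h : p.1 ∈ K
    · exact Or.inr fun h' => hp ⟨h, h'⟩
    · exact Or.inl h
  calc (γ : Measure (Euc d × Euc d)) (K ×ˢ M)ᶜ
      ≤ _ := (measure_mono hsub).trans (measure_union_le _ _)
    _ = μ.meas Kᶜ + ν.meas Mᶜ := by
        rw [← h1, ← h2, Measure.map_apply measurable_fst hK.measurableSet.compl,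
          Measure.map_apply measurable_snd hM.measurableSet.compl]
    _ ≤ ε / 2 + ε / 2 := add_le_add (hKε _ rfl) (hMε _ rfl)
    _ = ε := ENNReal.add_halves ε

/-- Optimal couplings exist. -/
theorem optimalCouplings_nonempty (μ ν : P2 d) : (optimalCouplings μ ν).Nonempty := by
  have hlsc : LowerSemicontinuous (fun γ : ProbabilityMeasure (Euc d × Euc d) =>
      cost (γ : Measure (Euc d × Euc d))) := by
    have := lowerSemicontinuous_lintegral (X := Euc d × Euc d) (fun p => ‖p.1 - p.2‖₊ ^ 2)
      (by fun_prop)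
    simpa [cost, enorm] using this
  obtain ⟨γ, hγ, hmin⟩ := (hlsc.lowerSemicontinuousOn _).exists_isMinOn
    ⟨⟨_, inferInstance⟩, prod_mem_couplings μ ν⟩ (isCompact_couplings μ ν)
  refine ⟨γ, hγ, le_antisymm ?_ (iInf₂_le (γ : Measure (Euc d × Euc d)) hγ)⟩
  refine le_iInf₂ fun γ' hγ' => ?_
  exact hmin (a := ⟨γ', hγ'.1⟩) hγ'

/-! ### Transport costs as integrals of random variables -/

theorem memLp_of_map_eq {Ω : Type*} [MeasurableSpace Ω] {σ : Measure Ω} {X : Ω → Euc d}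
    (hX : Measurable X) {μ : P2 d} (h : σ.map X = μ.meas) : MemLp X 2 σ := by
  have h2 : MemLp id 2 μ.meas := by
    refine ⟨aestronglyMeasurable_id, ?_⟩
    rw [eLpNorm_lt_top_iff_lintegral_rpow_enorm_lt_top (by norm_num) (by norm_num)]
    simpa [P2.meas] using μ.2
  rw [← h] at h2
  exact (memLp_map_measure_iff h2.1 hX.aemeasurable).1 h2

theorem integral_norm_sq_of_map_eq {Ω : Type*} [MeasurableSpace Ω] {σ : Measure Ω}
    {X : Ω → Euc d} (hX : Measurable X) {μ : P2 d} (h : σ.map X = μ.meas) :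
    ∫ ω, ‖X ω‖ ^ 2 ∂σ = ∫ x, ‖x‖ ^ 2 ∂μ.meas := by
  rw [← h, integral_map hX.aemeasurable (by fun_prop)]

theorem cost_map_toReal {Ω : Type*} [MeasurableSpace Ω] {σ : Measure Ω} {X Y : Ω → Euc d}
    (hX : Measurable X) (hY : Measurable Y) :
    (cost (σ.map fun ω => (X ω, Y ω))).toReal = ∫ ω, ‖X ω - Y ω‖ ^ 2 ∂σ := by
  rw [cost, lintegral_map (by fun_prop) (by fun_prop),
    integral_eq_lintegral_of_nonneg_ae (Eventually.of_forall fun _ => by positivity)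
      (by fun_prop)]
  congr 1
  refine lintegral_congr fun ω => ?_
  rw [← ofReal_norm, ENNReal.ofReal_pow (norm_nonneg _)]

theorem cost_map_ne_top {Ω : Type*} [MeasurableSpace Ω] {σ : Measure Ω} {X Y : Ω → Euc d}
    (hX : Measurable X) (hY : Measurable Y) {μ ν : P2 d} (hμ : σ.map X = μ.meas)
    (hν : σ.map Y = ν.meas) : cost (σ.map fun ω => (X ω, Y ω)) ≠ ∞ := by
  have h := ((memLp_of_map_eq hX hμ).sub (memLp_of_map_eq hY hν)).2
  rw [eLpNorm_lt_top_iff_lintegral_rpow_enorm_lt_top (by norm_num) (by norm_num)] at h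
  rw [cost, lintegral_map (by fun_prop) (by fun_prop)]
  simpa using h.ne

theorem W2_sq (μ ν : P2 d) : W2 μ ν ^ 2 = (W2sq μ ν).toReal :=
  Real.sq_sqrt ENNReal.toReal_nonneg

theorem map_prodMk_mem_couplings {Ω : Type*} [MeasurableSpace Ω] {σ : Measure Ω}
    [IsProbabilityMeasure σ] {X Y : Ω → Euc d} (hX : Measurable X) (hY : Measurable Y)
    {μ ν : P2 d} (hμ : σ.map X = μ.meas) (hν : σ.map Y = ν.meas) :
    σ.map (fun ω => (X ω, Y ω)) ∈ couplings μ ν :=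
  ⟨Measure.isProbabilityMeasure_map (by fun_prop),
    by rw [Measure.map_map measurable_fst (by fun_prop)]; exact hμ,
    by rw [Measure.map_map measurable_snd (by fun_prop)]; exact hν⟩

theorem W2_sq_le_integral {Ω : Type*} [MeasurableSpace Ω] {σ : Measure Ω}
    [IsProbabilityMeasure σ] {X Y : Ω → Euc d} (hX : Measurable X) (hY : Measurable Y)
    {μ ν : P2 d} (hμ : σ.map X = μ.meas) (hν : σ.map Y = ν.meas) :
    W2 μ ν ^ 2 ≤ ∫ ω, ‖X ω - Y ω‖ ^ 2 ∂σ := by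
  rw [W2_sq, ← cost_map_toReal hX hY]
  exact ENNReal.toReal_mono (cost_map_ne_top hX hY hμ hν)
    (iInf₂_le _ (map_prodMk_mem_couplings hX hY hμ hν))

theorem integral_eq_W2_sq {Ω : Type*} [MeasurableSpace Ω] {σ : Measure Ω} {X Y : Ω → Euc d}
    (hX : Measurable X) (hY : Measurable Y) {μ ν : P2 d}
    (h : σ.map (fun ω => (X ω, Y ω)) ∈ optimalCouplings μ ν) :
    ∫ ω, ‖X ω - Y ω‖ ^ 2 ∂σ = W2 μ ν ^ 2 := by
  rw [W2_sq, ← cost_map_toReal hX hY, h.2]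

theorem W2_nonneg (μ ν : P2 d) : 0 ≤ W2 μ ν := Real.sqrt_nonneg _

theorem integrable_norm_sub_sq {Ω : Type*} [MeasurableSpace Ω] {σ : Measure Ω}
    {X Y : Ω → Euc d} (hX : MemLp X 2 σ) (hY : MemLp Y 2 σ) :
    Integrable (fun ω => ‖X ω - Y ω‖ ^ 2) σ :=
  (memLp_two_iff_integrable_sq_norm (hX.sub hY).1).1 (hX.sub hY)

/-! ### Extrapolation along the ray -/

/-- An optimal coupling of `μ 0` and `μ 1` generates the whole ray by linear extrapolation. -/
theorem IsGeodesicRay.map_extrapolate {μ : ℝ≥0 → P2 d} (hμ : IsGeodesicRay μ)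
    {γ : Measure (Euc d × Euc d)} (hγ : γ ∈ optimalCouplings (μ 0) (μ 1)) {t : ℝ≥0} (ht : 1 < t) :
    γ.map (fun p => p.1 + (t : ℝ) • (p.2 - p.1)) = (μ t).meas := by
  obtain ⟨η, hη⟩ := optimalCouplings_nonempty (μ 1) (μ t)
  have := hγ.1.1
  have := hη.1.1
  obtain ⟨σ, hσ, hσγ, hση⟩ := exists_gluing γ η Prod.snd measurable_snd
    (hγ.1.2.2.trans hη.1.2.1.symm)
  have h0 : σ.map (fun q => q.1.1) = (μ 0).meas := by
    rw [← hγ.1.2.1, ← hσγ, Measure.map_map measurable_fst measurable_fst]; rfl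
  have h1 : σ.map (fun q => q.1.2) = (μ 1).meas := by
    rw [← hγ.1.2.2, ← hσγ, Measure.map_map measurable_snd measurable_fst]; rfl
  have h2 : σ.map (fun q => q.2) = (μ t).meas := by
    rw [← hη.1.2.2, ← hση, Measure.map_map measurable_snd (by fun_prop)]; rfl
  have m0 : Measurable (fun q : (Euc d × Euc d) × Euc d => q.1.1) := by fun_prop
  have m1 : Measurable (fun q : (Euc d × Euc d) × Euc d => q.1.2) := by fun_prop
  have m2 : Measurable (fun q : (Euc d × Euc d) × Euc d => q.2) := by fun_prop
  have L0 := memLp_of_map_eq m0 h0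
  have L1 := memLp_of_map_eq m1 h1
  have L2 := memLp_of_map_eq m2 h2
  set κ := W2 (μ 0) (μ 1) with hκ
  have hs : 0 < (t : ℝ) - 1 := by
    have : (1 : ℝ) < t := by exact_mod_cast ht
    linarith
  set s : ℝ := (t : ℝ) - 1 with hs_def
  have i01 : ∫ q, ‖q.1.1 - q.1.2‖ ^ 2 ∂σ = κ ^ 2 :=
    integral_eq_W2_sq m0 m1 (by change σ.map Prod.fst ∈ _; rwa [hσγ])
  have i12 : ∫ q, ‖q.1.2 - q.2‖ ^ 2 ∂σ = s ^ 2 * κ ^ 2 := by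
    rw [integral_eq_W2_sq m1 m2 (μ := μ 1) (ν := μ t) (by rwa [hση]), hμ t 1, mul_pow, sq_abs,
      hs_def, NNReal.coe_one]
    ring
  have i02 : (1 + s) ^ 2 * κ ^ 2 ≤ ∫ q, ‖q.1.1 - q.2‖ ^ 2 ∂σ := by
    refine le_trans (le_of_eq ?_) (W2_sq_le_integral m0 m2 h0 h2)
    rw [hμ t 0, mul_pow, sq_abs, hs_def, NNReal.coe_zero]
    ring
  -- With `a = x₁ - x₀` and `b = x_t - x₁`, this square is the defect in `‖a + b‖² ≤ (1 + s)(‖a‖² +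
  -- ‖b‖² / s)`, scaled by `s`.
  have hpt : ∀ q : (Euc d × Euc d) × Euc d, ‖(q.2 - q.1.2) - s • (q.1.2 - q.1.1)‖ ^ 2 =
      (1 + s) * (s * ‖q.1.1 - q.1.2‖ ^ 2 + ‖q.1.2 - q.2‖ ^ 2) - s * ‖q.1.1 - q.2‖ ^ 2 := by
    intro q
    have e1 : q.1.1 - q.1.2 = -(q.1.2 - q.1.1) := by abel
    have e2 : q.1.2 - q.2 = -(q.2 - q.1.2) := by abel
    have e3 : q.1.1 - q.2 = -((q.1.2 - q.1.1) + (q.2 - q.1.2)) := by abel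
    rw [e1, e2, e3, norm_neg, norm_neg, norm_neg, norm_sub_sq_real, norm_add_sq_real, norm_smul,
      mul_pow, inner_smul_right, real_inner_comm, Real.norm_eq_abs, sq_abs]
    ring
  have j01 := (integrable_norm_sub_sq L0 L1).const_mul s
  have j12 := integrable_norm_sub_sq L1 L2
  have j02 := (integrable_norm_sub_sq L0 L2).const_mul s
  -- The bounds balance exactly: `(1 + s)(sκ² + s²κ²) = s(1 + s)²κ²`.
  have hint : ∫ q, ‖(q.2 - q.1.2) - s • (q.1.2 - q.1.1)‖ ^ 2 ∂σ ≤ 0 := by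
    simp_rw [hpt]
    rw [integral_sub ((j01.fun_add j12).const_mul (1 + s)) j02, integral_const_mul,
      integral_const_mul, integral_add j01 j12, integral_const_mul, i01, i12]
    nlinarith [mul_le_mul_of_nonneg_left i02 hs.le]
  have hintg : Integrable (fun q : (Euc d × Euc d) × Euc d =>
      ‖(q.2 - q.1.2) - s • (q.1.2 - q.1.1)‖ ^ 2) σ := by
    simp_rw [hpt]
    exact ((j01.add j12).const_mul (1 + s)).sub j02
  have hae : (fun q : (Euc d × Euc d) × Euc d =>
      ‖(q.2 - q.1.2) - s • (q.1.2 - q.1.1)‖ ^ 2) =ᵐ[σ] 0 :=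
    (integral_eq_zero_iff_of_nonneg (fun _ => by positivity) hintg).1
      (le_antisymm hint (integral_nonneg fun _ => by positivity))
  rw [← h2, ← hσγ, Measure.map_map (by fun_prop) measurable_fst]
  refine Measure.map_congr ?_
  filter_upwards [hae] with q hq
  have hq' : (q.2 - q.1.2) - s • (q.1.2 - q.1.1) = 0 := by simpa using hq
  have : q.1.1 + (t : ℝ) • (q.1.2 - q.1.1) - q.2 =
      -((q.2 - q.1.2) - s • (q.1.2 - q.1.1)) := by
    rw [hs_def, sub_smul, one_smul]; abel
  rw [hq', neg_zero, sub_eq_zero] at this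
  exact this

/-! ### Asymptotics and expansion of the cost -/

theorem tendsto_sqrt_sq_add_sub (b C : ℝ) :
    Tendsto (fun a : ℝ => √(a ^ 2 + 2 * a * b + C) - a) atTop (𝓝 b) := by
  have hq : Tendsto (fun a : ℝ => 1 + 2 * b * a⁻¹ + C * a⁻¹ ^ 2) atTop (𝓝 1) := by
    have h := tendsto_inv_atTop_zero (𝕜 := ℝ)
    simpa using (tendsto_const_nhds (x := (1 : ℝ))).add (h.const_mul (2 * b)) |>.add
      ((h.pow 2).const_mul C)
  have hn : Tendsto (fun a : ℝ => 2 * b + C * a⁻¹) atTop (𝓝 (2 * b)) := by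
    simpa using (tendsto_const_nhds (x := 2 * b)).add
      ((tendsto_inv_atTop_zero (𝕜 := ℝ)).const_mul C)
  have hd : Tendsto (fun a : ℝ => √(1 + 2 * b * a⁻¹ + C * a⁻¹ ^ 2) + 1) atTop (𝓝 2) := by
    have := ((Real.continuous_sqrt.tendsto _).comp hq).add_const 1
    rw [Real.sqrt_one, one_add_one_eq_two] at this
    exact this
  have := hn.div hd (by norm_num)
  rw [mul_div_cancel_left₀ b (by norm_num : (2 : ℝ) ≠ 0)] at this
  refine this.congr' ?_
  -- Rationalising gives `(2b + C/a) / (√(1 + 2b/a + C/a²) + 1)`; the radicand must be positive to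
  -- square the root back.
  filter_upwards [eventually_gt_atTop 0, hq.eventually (lt_mem_nhds zero_lt_one)] with a ha hpos
  have e : a ^ 2 + 2 * a * b + C = a ^ 2 * (1 + 2 * b * a⁻¹ + C * a⁻¹ ^ 2) := by
    field_simp
  rw [e, Real.sqrt_mul (sq_nonneg a), Real.sqrt_sq ha.le]
  have hr := Real.sq_sqrt hpos.le
  have hr0 := Real.sqrt_nonneg (1 + 2 * b * a⁻¹ + C * a⁻¹ ^ 2)
  simp only [Pi.div_apply]
  rw [div_eq_iff (by positivity)]
  have : (a * √(1 + 2 * b * a⁻¹ + C * a⁻¹ ^ 2) - a) * (√(1 + 2 * b * a⁻¹ + C * a⁻¹ ^ 2) + 1) =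
      a * (√(1 + 2 * b * a⁻¹ + C * a⁻¹ ^ 2) ^ 2 - 1) := by ring
  rw [this, hr]
  field_simp
  ring

theorem integrable_inner_sub {Ω : Type*} [MeasurableSpace Ω] {σ : Measure Ω}
    {X Y Z : Ω → Euc d} (hX : MemLp X 2 σ) (hY : MemLp Y 2 σ) (hZ : MemLp Z 2 σ) :
    Integrable (fun ω => inner ℝ (Y ω - X ω) (Z ω - X ω)) σ := by
  refine Integrable.mono' ((integrable_norm_sub_sq hY hX).add (integrable_norm_sub_sq hZ hX))
    ((hY.sub hX).1.inner (hZ.sub hX).1) (Eventually.of_forall fun ω => ?_)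
  refine (norm_inner_le_norm _ _).trans ?_
  simp only [Pi.add_apply]
  nlinarith [sq_nonneg (‖Y ω - X ω‖ - ‖Z ω - X ω‖), sq_nonneg ‖Y ω - X ω‖,
    sq_nonneg ‖Z ω - X ω‖]

theorem integral_norm_extrapolate_sub_sq {Ω : Type*} [MeasurableSpace Ω] {σ : Measure Ω}
    {X Y Z : Ω → Euc d} (hX : MemLp X 2 σ) (hY : MemLp Y 2 σ) (hZ : MemLp Z 2 σ) (t : ℝ) :
    ∫ ω, ‖X ω + t • (Y ω - X ω) - Z ω‖ ^ 2 ∂σ = t ^ 2 * ∫ ω, ‖X ω - Y ω‖ ^ 2 ∂σ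
      - 2 * t * ∫ ω, inner ℝ (Y ω - X ω) (Z ω - X ω) ∂σ + ∫ ω, ‖X ω - Z ω‖ ^ 2 ∂σ := by
  have hpt : ∀ ω, ‖X ω + t • (Y ω - X ω) - Z ω‖ ^ 2 = t ^ 2 * ‖X ω - Y ω‖ ^ 2
      - 2 * t * inner ℝ (Y ω - X ω) (Z ω - X ω) + ‖X ω - Z ω‖ ^ 2 := by
    intro ω
    have e : X ω + t • (Y ω - X ω) - Z ω = t • (Y ω - X ω) - (Z ω - X ω) := by abel
    rw [e, norm_sub_sq_real, norm_smul, mul_pow, inner_smul_left, Real.norm_eq_abs, sq_abs,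
      norm_sub_rev (X ω) (Y ω), norm_sub_rev (X ω) (Z ω)]
    simp only [conj_trivial]
    ring
  have jXY := (integrable_norm_sub_sq hX hY).const_mul (t ^ 2)
  have jI := (integrable_inner_sub hX hY hZ).const_mul (2 * t)
  simp_rw [hpt]
  rw [integral_add (jXY.sub' jI) (integrable_norm_sub_sq hX hZ), integral_sub jXY jI,
    integral_const_mul, integral_const_mul]

/-! ### Three-plans -/

theorem map_mem_Gam {Ω : Type*} [MeasurableSpace Ω] {σ : Measure Ω} [IsProbabilityMeasure σ]
    {X Y Z : Ω → Euc d} (hX : Measurable X) (hY : Measurable Y) (hZ : Measurable Z)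
    {μ₀ μ₁ ν : P2 d} (h : σ.map (fun ω => (X ω, Y ω)) ∈ optimalCouplings μ₀ μ₁)
    (hν : σ.map Z = ν.meas) : σ.map (fun ω => (X ω, Y ω, Z ω)) ∈ Gam μ₀ μ₁ ν := by
  have hm : Measurable fun ω => (X ω, Y ω, Z ω) := by fun_prop
  refine ⟨⟨Measure.isProbabilityMeasure_map hm.aemeasurable, ?_, ?_, ?_⟩, ?_⟩
  · rw [← h.1.2.1, Measure.map_map (by fun_prop) hm,
      Measure.map_map (by fun_prop) (by fun_prop)]; rfl
  · rw [← h.1.2.2, Measure.map_map (by fun_prop) hm,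
      Measure.map_map (by fun_prop) (by fun_prop)]; rfl
  · rw [← hν, Measure.map_map (by fun_prop) hm]; rfl
  · rw [Measure.map_map (by fun_prop) hm]; exact h

theorem Gam_nonempty (μ₀ μ₁ ν : P2 d) : (Gam μ₀ μ₁ ν).Nonempty := by
  obtain ⟨γ, hγ⟩ := optimalCouplings_nonempty μ₀ μ₁
  have := hγ.1.1
  refine ⟨_, map_mem_Gam (σ := γ.prod ν.meas) (X := fun q => q.1.1) (Y := fun q => q.1.2)
    (Z := fun q => q.2) (by fun_prop) (by fun_prop) (by fun_prop) ?_ Measure.snd_prod⟩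
  change (γ.prod ν.meas).map Prod.fst ∈ _
  rwa [show (γ.prod ν.meas).map Prod.fst = γ from Measure.fst_prod]

section Gam

variable {μ₀ μ₁ ν : P2 d} {γ : Measure (Euc d × Euc d × Euc d)}

theorem memLp_of_mem_Gam (hγ : γ ∈ Gam μ₀ μ₁ ν) :
    MemLp (fun p => p.1) 2 γ ∧ MemLp (fun p => p.2.1) 2 γ ∧ MemLp (fun p => p.2.2) 2 γ :=
  ⟨memLp_of_map_eq (by fun_prop) hγ.1.2.1, memLp_of_map_eq (by fun_prop) hγ.1.2.2.1,
    memLp_of_map_eq (by fun_prop) hγ.1.2.2.2⟩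

theorem integrable_inner_of_mem_Gam (hγ : γ ∈ Gam μ₀ μ₁ ν) :
    Integrable (fun p : Euc d × Euc d × Euc d => inner ℝ (p.2.1 - p.1) (p.2.2 - p.1)) γ :=
  have ⟨h0, h1, h2⟩ := memLp_of_mem_Gam hγ
  integrable_inner_sub h0 h1 h2

theorem integral_norm_extrapolate_of_mem_Gam (hγ : γ ∈ Gam μ₀ μ₁ ν) (t : ℝ) :
    ∫ p, ‖p.1 + t • (p.2.1 - p.1) - p.2.2‖ ^ 2 ∂γ = t ^ 2 * W2 μ₀ μ₁ ^ 2
      - 2 * t * ∫ p, inner ℝ (p.2.1 - p.1) (p.2.2 - p.1) ∂γ + ∫ p, ‖p.1 - p.2.2‖ ^ 2 ∂γ := by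
  obtain ⟨h0, h1, h2⟩ := memLp_of_mem_Gam hγ
  rw [integral_norm_extrapolate_sub_sq h0 h1 h2,
    integral_eq_W2_sq (by fun_prop) (by fun_prop) hγ.2]

/-- The bound depends only on the marginals, so it is uniform over the 3-plans and makes the infimum
finite. -/
theorem integral_inner_le_of_mem_Gam (hγ : γ ∈ Gam μ₀ μ₁ ν) :
    ∫ p, inner ℝ (p.2.1 - p.1) (p.2.2 - p.1) ∂γ ≤
      W2 μ₀ μ₁ ^ 2 + 2 * (∫ x, ‖x‖ ^ 2 ∂μ₀.meas + ∫ x, ‖x‖ ^ 2 ∂ν.meas) := by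
  obtain ⟨h0, h1, h2⟩ := memLp_of_mem_Gam hγ
  have j0 := (memLp_two_iff_integrable_sq_norm h0.1).1 h0
  have j2 := (memLp_two_iff_integrable_sq_norm h2.1).1 h2
  have j01 := integrable_norm_sub_sq h0 h1
  have m0 : Measurable fun p : Euc d × Euc d × Euc d => p.1 := by fun_prop
  have m1 : Measurable fun p : Euc d × Euc d × Euc d => p.2.1 := by fun_prop
  have m2 : Measurable fun p : Euc d × Euc d × Euc d => p.2.2 := by fun_prop
  rw [← integral_eq_W2_sq m0 m1 hγ.2, ← integral_norm_sq_of_map_eq m0 hγ.1.2.1,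
    ← integral_norm_sq_of_map_eq m2 hγ.1.2.2.2, ← integral_add j0 j2, ← integral_const_mul,
    ← integral_add j01 ((j0.fun_add j2).const_mul 2)]
  refine integral_mono (integrable_inner_sub h0 h1 h2) (j01.add ((j0.add j2).const_mul 2))
    fun p => ?_
  have e1 := real_inner_le_norm (p.2.1 - p.1) (p.2.2 - p.1)
  have e2 : ‖p.2.2 - p.1‖ ≤ ‖p.2.2‖ + ‖p.1‖ := norm_sub_le _ _
  have e3 : ‖p.2.2 - p.1‖ ^ 2 ≤ (‖p.2.2‖ + ‖p.1‖) ^ 2 := by gcongr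
  change _ ≤ ‖p.1 - p.2.1‖ ^ 2 + 2 * (‖p.1‖ ^ 2 + ‖p.2.2‖ ^ 2)
  rw [norm_sub_rev p.1 p.2.1]
  nlinarith [sq_nonneg (‖p.2.1 - p.1‖ - ‖p.2.2 - p.1‖), sq_nonneg ‖p.2.1 - p.1‖,
    sq_nonneg ‖p.2.2 - p.1‖, sq_nonneg (‖p.2.2‖ - ‖p.1‖)]

end Gam

/-! ### Two-sided bounds and the limit -/

/-- Every 3-plan bounds the distance to the ray from above. -/
theorem IsGeodesicRay.W2_sq_le {μ : ℝ≥0 → P2 d} (hμ : IsGeodesicRay μ) {ν : P2 d}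
    {γ : Measure (Euc d × Euc d × Euc d)} (hγ : γ ∈ Gam (μ 0) (μ 1) ν) {t : ℝ≥0} (ht : 1 < t) :
    W2 (μ t) ν ^ 2 ≤ (t : ℝ) ^ 2 * speed μ ^ 2
      - 2 * t * ∫ p, inner ℝ (p.2.1 - p.1) (p.2.2 - p.1) ∂γ + ∫ p, ‖p.1 - p.2.2‖ ^ 2 ∂γ := by
  have := hγ.1.1
  rw [speed, ← integral_norm_extrapolate_of_mem_Gam hγ]
  refine W2_sq_le_integral (by fun_prop) (by fun_prop) ?_ hγ.1.2.2.2
  rw [← hμ.map_extrapolate hγ.2 ht, Measure.map_map (by fun_prop) (by fun_prop)]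
  rfl

/-- A lower bound over all 3-plans bounds the distance to the ray from below. -/
theorem IsGeodesicRay.le_W2_sq {μ : ℝ≥0 → P2 d} (hμ : IsGeodesicRay μ) (hκ : 0 < speed μ)
    {ν : P2 d} {c : ℝ} (hc : ∀ γ ∈ Gam (μ 0) (μ 1) ν,
      c ≤ -(speed μ)⁻¹ * ∫ p, inner ℝ (p.2.1 - p.1) (p.2.2 - p.1) ∂γ)
    {t : ℝ≥0} (ht : 1 < t) :
    (speed μ * t) ^ 2 + 2 * (speed μ * t) * c ≤ W2 (μ t) ν ^ 2 := by
  obtain ⟨γ, hγ⟩ := optimalCouplings_nonempty (μ 0) (μ 1)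
  obtain ⟨π, hπ⟩ := optimalCouplings_nonempty (μ t) ν
  have := hγ.1.1
  have := hπ.1.1
  -- The gluing runs along the extrapolated point, whose law is `μ t`, so `(x₀, x₁)` keeps its
  -- optimal law `γ`.
  obtain ⟨σ, hσ, hσγ, hσπ⟩ := exists_gluing γ π (fun p => p.1 + (t : ℝ) • (p.2 - p.1))
    (by fun_prop) ((hμ.map_extrapolate hγ ht).trans hπ.1.2.1.symm)
  have hm : Measurable fun q : (Euc d × Euc d) × Euc d => (q.1.1, q.1.2, q.2) := by fun_prop
  have hG : σ.map (fun q => (q.1.1, q.1.2, q.2)) ∈ Gam (μ 0) (μ 1) ν := by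
    refine map_mem_Gam (by fun_prop) (by fun_prop) (by fun_prop) ?_ ?_
    · change σ.map Prod.fst ∈ _
      rwa [hσγ]
    · rw [← hπ.1.2.2, ← hσπ, Measure.map_map measurable_snd (by fun_prop)]; rfl
  have hW := integral_norm_extrapolate_of_mem_Gam hG t
  rw [integral_map hm.aemeasurable (Measurable.aestronglyMeasurable (by fun_prop)),
    integral_eq_W2_sq (X := fun q : (Euc d × Euc d) × Euc d => q.1.1 + (t : ℝ) • (q.1.2 - q.1.1))
      (Y := fun q => q.2) (by fun_prop) (by fun_prop) (by rwa [hσπ])] at hW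
  rw [hW]
  have hJ := hc _ hG
  set J := ∫ p, inner ℝ (p.2.1 - p.1) (p.2.2 - p.1)
    ∂(σ.map fun q : (Euc d × Euc d) × Euc d => (q.1.1, q.1.2, q.2))
  have hJ' : speed μ * c ≤ -J := by
    have := mul_le_mul_of_nonneg_left hJ hκ.le
    rwa [← mul_assoc, mul_neg, mul_inv_cancel₀ hκ.ne', neg_one_mul] at this
  have hC : 0 ≤ ∫ p, ‖p.1 - p.2.2‖ ^ 2
      ∂(σ.map fun q : (Euc d × Euc d) × Euc d => (q.1.1, q.1.2, q.2)) :=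
    integral_nonneg fun _ => by positivity
  rw [← speed]
  nlinarith [mul_le_mul_of_nonneg_left hJ' t.coe_nonneg]

/-- The Busemann limit is the infimum over 3-plans. -/
theorem IsGeodesicRay.tendsto_of_isGLB {μ : ℝ≥0 → P2 d} (hμ : IsGeodesicRay μ)
    (hκ : 0 < speed μ) {ν : P2 d} {b : ℝ}
    (hb : IsGLB ((fun γ : Measure (Euc d × Euc d × Euc d) =>
      -(speed μ)⁻¹ * ∫ p, inner ℝ (p.2.1 - p.1) (p.2.2 - p.1) ∂γ) '' Gam (μ 0) (μ 1) ν) b) :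
    Tendsto (fun t : ℝ≥0 => W2 (μ t) ν - speed μ * (t : ℝ)) atTop (𝓝 b) := by
  have hlim : Tendsto (fun t : ℝ≥0 => speed μ * (t : ℝ)) atTop atTop :=
    (NNReal.tendsto_coe_atTop.2 tendsto_id).const_mul_atTop hκ
  rw [tendsto_order]
  constructor
  · intro a ha
    -- `C = 0` here because the lower bound discards the constant term.
    have hl := ((tendsto_sqrt_sq_add_sub b 0).comp hlim).eventually (lt_mem_nhds ha)
    filter_upwards [hl, eventually_gt_atTop 1] with t h1 ht
    refine h1.trans_le ?_
    simp only [Function.comp_apply, add_zero]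
    gcongr
    exact Real.sqrt_le_iff.2 ⟨W2_nonneg _ _,
      hμ.le_W2_sq hκ (fun γ hγ => hb.1 ⟨γ, hγ, rfl⟩) ht⟩
  · intro a ha
    -- A single near-optimal 3-plan, fixed independently of `t`, suffices for the upper bound.
    obtain ⟨_, ⟨γ, hγ, rfl⟩, -, hlt⟩ := hb.exists_between ha
    simp only at hlt
    have hl := ((tendsto_sqrt_sq_add_sub _ (∫ p, ‖p.1 - p.2.2‖ ^ 2 ∂γ)).comp hlim).eventually
      (gt_mem_nhds hlt)
    filter_upwards [hl, eventually_gt_atTop 1] with t h1 ht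
    refine lt_of_le_of_lt ?_ h1
    simp only [Function.comp_apply]
    gcongr
    refine Real.le_sqrt_of_sq_le ((hμ.W2_sq_le hγ ht).trans (le_of_eq ?_))
    field_simp
    ring

end BusemannWasserstein

open BusemannWasserstein in
/-- For a (non-constant) geodesic ray, the limit defining the Busemann function exists, the
integrals over the 3-plans are well defined, and the Busemann function is their infimum
(in particular the set of 3-plans is nonempty and the infimum is finite). -/
theorem proposition3 (d : ℕ) (μ : ℝ≥0 → P2 d) (hμ : IsGeodesicRay μ) (hκ : 0 < speed μ)
    (ν : P2 d) :
    Tendsto (fun t : ℝ≥0 => W2 (μ t) ν - speed μ * (t : ℝ)) atTop (𝓝 (busemann μ ν)) ∧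
    (∀ γ ∈ Gam (μ 0) (μ 1) ν,
      Integrable (fun p : Euc d × Euc d × Euc d => inner ℝ (p.2.1 - p.1) (p.2.2 - p.1)) γ) ∧
    IsGLB ((fun γ : Measure (Euc d × Euc d × Euc d) =>
        -(speed μ)⁻¹ * ∫ p, inner ℝ (p.2.1 - p.1) (p.2.2 - p.1) ∂γ) '' Gam (μ 0) (μ 1) ν)
      (busemann μ ν) := by
  have hglb := isGLB_csInf ((Gam_nonempty (μ 0) (μ 1) ν).image
      (fun γ : Measure (Euc d × Euc d × Euc d) =>
        -(speed μ)⁻¹ * ∫ p, inner ℝ (p.2.1 - p.1) (p.2.2 - p.1) ∂γ)) (by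
    refine ⟨-(speed μ)⁻¹ * (W2 (μ 0) (μ 1) ^ 2 +
      2 * (∫ x, ‖x‖ ^ 2 ∂(μ 0).meas + ∫ x, ‖x‖ ^ 2 ∂ν.meas)), ?_⟩
    rintro _ ⟨γ, hγ, rfl⟩
    exact mul_le_mul_of_nonpos_left (integral_inner_le_of_mem_Gam hγ)
      (neg_nonpos.2 (inv_nonneg.2 hκ.le)))
  have hlim := hμ.tendsto_of_isGLB hκ hglb
  have heq : busemann μ ν = _ := hlim.limUnder_eq
  rw [heq]
  exact ⟨hlim, fun γ hγ => integrable_inner_of_mem_Gam hγ, hglb⟩
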